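/- Let $p$ be an odd prime and let $f:\{1,2,3,\dots\}\to\{-1,1\}$ be a character-like function associated to $p$, that is, a completely multiplicative function ($f(1)=1$ and $f(mn)=f(m)f(n)$ for all $m,n\ge 1$) such that $f(kp+i)=f(i)$ for all integers $k\ge 0$ and $1\le i\le p-1$; the value $f(p)\in\{-1,1\}$ is arbitrary. Assume that $f$ is not identically $1$. Let $F(z)=\sum_{n=1}^{\infty}f(n)z^n$ for $|z|<1$. Then the number $$\varphi_p:=F\left(\tfrac12\right)=\sum_{n=1}^{\infty}\frac{f(n)}{2^n}$$ is transcendental (over $\mathbb{Q}$). -/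

import Mathlib

/-- `f` is a character-like function associated to `p`: a completely multiplicative function from
the positive integers to `{-1, 1}` with `f 1 = 1` and `f (k * p + i) = f i` for `1 ≤ i ≤ p - 1`,
`k ≥ 0` (the sign of `f p` is free). The value `f 0` plays no role. -/
structure IsCharacterLike (p : ℕ) (f : ℕ → ℤ) : Prop where
  values : ∀ n : ℕ, 1 ≤ n → f n = 1 ∨ f n = -1
  map_one : f 1 = 1
  map_mul : ∀ m n : ℕ, 1 ≤ m → 1 ≤ n → f (m * n) = f m * f n
  map_add : ∀ k i : ℕ, 1 ≤ i → i < p → f (k * p + i) = f i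

/-- The generating function `F(z) = ∑_{n ≥ 1} f(n) z ^ n`. -/
noncomputable def generatingFunction (f : ℕ → ℤ) (z : ℂ) : ℂ :=
  ∑' n : ℕ, (f (n + 1) : ℂ) * z ^ (n + 1)

/-!
The proof is Mahler's method. Summing over residue classes modulo `p` gives
`F(z) = P(z) / (1 - z ^ p) + f(p) F(z ^ p)` with `P = ∑ f(i) X ^ i`, `1 ≤ i < p`. For
`G(z) = (1 - z) F(z)` and `S = 1 + X + ⋯ + X ^ (p - 1)` this becomes the equation
`G(z ^ p) = f(p) (S(z) G(z) - P(z))` with polynomial coefficients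
(`IsCharacterLike.mahlerFunction_pow`), and it suffices to treat `G(1/2) = F(1/2) / 2`.

*`G` is a transcendental function.* If it were algebraic, the next-to-leading coefficient of a
relation of minimal degree would give a rational solution of the same equation
(`exists_rational_solution_of_algebraic`). A denominator `B` in lowest terms satisfies
`B(z ^ p) ∣ B(z)`, so the solution is a polynomial (`exists_polynomial_solution`), of degree at most
`1` by comparing degrees, and this forces `f = 1` (`IsCharacterLike.eq_one_of_polynomial_solution`).

*`G(1/2)` is a transcendental number.* Suppose that `α = G(1/2)` is algebraic. Linear algebra gives
an integer polynomial in `z` and `G(z)`, of degree at most `N` in each, whose value `E(z)` vanishes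
to order at least `N ^ 2` at `0`; since `G` is transcendental, `E(z) ≠ 0` for small `z ≠ 0`
(`IsCharacterLike.exists_auxiliary_function`). Put `W = 2 ^ p ^ k`. Iterating the equation of `G`
gives `W G(1 / W) = m α + n` with integers `m, n = O(W)` (`IsCharacterLike.exists_linear_form`), so
that `W ^ (2 N) E(1 / W)` is, up to a constant factor, a nonzero algebraic integer in `ℚ(α)` whose
conjugates are `O(W ^ (2 N))`, while it is itself `O(W ^ (2 N - N ^ 2))`. For `N` large compared with
the degree of `α` and `k → ∞`, its norm would be a nonzero integer of absolute value less than `1`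
(`exists_liouville_bound`).
-/

open Polynomial Filter Topology

/-! ### Algebraic solutions of a Mahler equation -/

/-- The two leading coefficients after a linear substitution. -/
theorem coeff_comp_linear {R : Type*} [CommRing R] (q : R[X]) (a b : R) {d : ℕ}
    (hq : q.natDegree ≤ d + 1) :
    (q.comp (C a * X - C b)).coeff d = q.coeff d * a ^ d - (d + 1) * q.coeff (d + 1) * a ^ d * b ∧
    (q.comp (C a * X - C b)).coeff (d + 1) = q.coeff (d + 1) * a ^ (d + 1) := by
  have hlin : ∀ i n, ((C a * X - C b) ^ i).coeff n = (-b) ^ (i - n) * (i.choose n) * a ^ n := by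
    intro i n
    have : (C a * X - C b) ^ i = ((X - C b) ^ i).comp (C a * X) := by simp
    rw [this, comp_C_mul_X_coeff, sub_eq_add_neg, ← C_neg, coeff_X_add_C_pow]
  have hcomp : q.comp (C a * X - C b) =
      ∑ i ∈ Finset.range (d + 2), C (q.coeff i) * (C a * X - C b) ^ i := by
    rw [comp, eval₂_eq_sum_range' C (n := d + 2) (by omega)]
  have hcoeff : ∀ n, (q.comp (C a * X - C b)).coeff n = ∑ i ∈ Finset.range (d + 2),
      q.coeff i * ((-b) ^ (i - n) * (i.choose n) * a ^ n) := by
    intro n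
    rw [hcomp, finsetSum_coeff]
    exact Finset.sum_congr rfl fun i _ => by rw [coeff_C_mul, hlin]
  rw [hcoeff, hcoeff, Finset.sum_range_succ, Finset.sum_range_succ, Finset.sum_range_succ,
    Finset.sum_range_succ]
  refine ⟨?_, ?_⟩
  · rw [Finset.sum_eq_zero]
    · simp
      ring
    · intro i hi
      rw [Nat.choose_eq_zero_of_lt (Finset.mem_range.mp hi)]
      simp
  · rw [Finset.sum_eq_zero]
    · simp
    · intro i hi
      rw [Nat.choose_eq_zero_of_lt (by have := Finset.mem_range.mp hi; omega)]
      simp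

theorem natDegree_comp_linear_le {R : Type*} [CommRing R] (q : R[X]) (a b : R) :
    (q.comp (C a * X - C b)).natDegree ≤ q.natDegree := by
  refine natDegree_comp_le.trans ?_
  have : (C a * X - C b).natDegree ≤ 1 := by compute_degree
  nlinarith

theorem eq_zero_of_eventually_eval_eq_zero {q : ℂ[X]} (h : ∀ᶠ z in 𝓝 (0 : ℂ), q.eval z = 0) :
    q = 0 := by
  have hinf : Set.Infinite {z | q.eval z = 0} := infinite_of_mem_nhds (0 : ℂ) h
  exact q.eq_zero_of_infinite_isRoot hinf

/-- If `G` satisfies the Mahler equation `G (z ^ p) = U z * G z - V z` near `0` and is algebraic over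
`ℂ(z)`, then that equation has a rational solution `A / B`. Comparing a relation for `G` of minimal
degree `d` with the one obtained from it by `z ↦ z ^ p`, the solution is minus the coefficient of
`Y ^ (d - 1)` divided by `d` times that of `Y ^ d`. -/
theorem exists_rational_solution_of_algebraic {p : ℕ} (hp : 0 < p) {U V : ℂ[X]} (hU : U ≠ 0)
    {G : ℂ → ℂ} (hG : ∀ᶠ z in 𝓝 (0 : ℂ), G (z ^ p) = U.eval z * G z - V.eval z)
    {Q : ℂ[X][X]} (hQ : Q ≠ 0) (hQG : ∀ᶠ z in 𝓝 (0 : ℂ), Q.evalEval z (G z) = 0) :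
    ∃ A B : ℂ[X], B ≠ 0 ∧ expand ℂ p A * B = (U * A - V * B) * expand ℂ p B := by
  induction hn : Q.natDegree using Nat.strong_induction_on generalizing Q with
  | _ n ih =>
  subst hn
  rcases Nat.eq_zero_or_pos Q.natDegree with h0 | hpos
  · exfalso
    rw [eq_C_of_natDegree_eq_zero h0] at hQG hQ
    simp only [evalEval_C] at hQG
    exact hQ (by rw [eq_zero_of_eventually_eval_eq_zero hQG, C_0])
  obtain ⟨d, hd⟩ : ∃ d, Q.natDegree = d + 1 := ⟨_, (Nat.succ_pred_eq_of_pos hpos).symm⟩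
  set σ : ℂ[X] →+* ℂ[X] := (expand ℂ p : ℂ[X] →+* ℂ[X]) with hσ
  have hσapp : ∀ q, σ q = expand ℂ p q := fun q => rfl
  -- `Q'` is the relation at `z ^ p`, rewritten in terms of `G z`, and `H` is the combination of
  -- `Q` and `Q'` in which the leading terms cancel. If `H ≠ 0`, it is a relation of smaller degree;
  -- if `H = 0`, its next coefficient is the equation for `A / B`.
  set Q' : ℂ[X][X] := (Q.map σ).comp (C U * X - C V) with hQ'
  set H : ℂ[X][X] := C (Q.coeff (d + 1)) * Q' - C (U ^ (d + 1) * σ (Q.coeff (d + 1))) * Q with hH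
  have hmapdeg : (Q.map σ).natDegree ≤ d + 1 := hd ▸ natDegree_map_le
  have hlead : Q.coeff (d + 1) ≠ 0 := by
    rw [← hd]; exact leadingCoeff_ne_zero.mpr hQ
  obtain ⟨hc0, hc1⟩ := coeff_comp_linear (Q.map σ) U V hmapdeg
  rw [← hQ', coeff_map, coeff_map] at hc0
  rw [← hQ', coeff_map] at hc1
  have hHdeg : H.natDegree ≤ d := by
    rw [natDegree_le_iff_coeff_eq_zero]
    intro N hN
    rcases (Nat.succ_le_of_lt hN).eq_or_lt with h | h
    · rw [← h, Nat.succ_eq_add_one, hH, coeff_sub, coeff_C_mul, coeff_C_mul, hc1]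
      ring
    · rw [hH, coeff_sub, coeff_C_mul, coeff_C_mul,
        coeff_eq_zero_of_natDegree_lt (p := Q) (hd.trans_lt h),
        coeff_eq_zero_of_natDegree_lt (p := Q')]
      · simp
      · exact ((natDegree_comp_linear_le (Q.map σ) U V).trans hmapdeg).trans_lt h
  have hQ'eval : ∀ z y, Q'.evalEval z y = Q.evalEval (z ^ p) (U.eval z * y - V.eval z) := by
    intro z y
    have hc : (evalRingHom z).comp σ = evalRingHom (z ^ p) := by
      ext <;> simp [hσapp]
    rw [hQ', ← eval₂_evalRingHom, eval₂_comp, eval₂_map, hc, ← eval₂_evalRingHom]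
    simp
  have htend : Tendsto (fun z : ℂ => z ^ p) (𝓝 0) (𝓝 0) := by
    have := (continuous_pow p).tendsto (0 : ℂ)
    rwa [zero_pow hp.ne'] at this
  have hHG : ∀ᶠ z in 𝓝 (0 : ℂ), H.evalEval z (G z) = 0 := by
    filter_upwards [hQG, htend.eventually hQG, hG] with z h1 h2 h3
    rw [hH, evalEval_sub, evalEval_mul, evalEval_mul, hQ'eval, ← h3, h1, h2]
    simp
  by_cases hH0 : H = 0
  · refine ⟨-Q.coeff d, (d + 1) * Q.coeff (d + 1),
      mul_ne_zero (by exact_mod_cast d.succ_ne_zero) hlead, ?_⟩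
    have hk : H.coeff d = 0 := by rw [hH0, coeff_zero]
    rw [hH, coeff_sub, coeff_C_mul, coeff_C_mul, hc0] at hk
    have hk2 : Q.coeff (d + 1) * (σ (Q.coeff d) - (d + 1) * σ (Q.coeff (d + 1)) * V) -
        U * σ (Q.coeff (d + 1)) * Q.coeff d = 0 := by
      apply (mul_eq_zero.mp (?_ : U ^ d * _ = 0)).resolve_left (pow_ne_zero d hU)
      linear_combination hk
    simp only [map_neg, map_mul, map_add, map_natCast, map_one]
    simp only [hσapp] at hk2
    linear_combination (-(d + 1) : ℂ[X]) * hk2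
  · exact ih _ (by omega) hH0 hHG rfl

/-- A rational solution of `b (z ^ p) = U * b - V` is a polynomial: in lowest terms the denominator
`B` satisfies `B (z ^ p) ∣ B`, hence is constant. -/
theorem exists_polynomial_solution {p : ℕ} (hp : 2 ≤ p) {U V A B : ℂ[X]} (hB : B ≠ 0)
    (h : expand ℂ p A * B = (U * A - V * B) * expand ℂ p B) :
    ∃ A₁ : ℂ[X], expand ℂ p A₁ = U * A₁ - V := by
  classical
  set g := EuclideanDomain.gcd A B with hg
  have hg0 : g ≠ 0 := fun h0 => hB (EuclideanDomain.gcd_eq_zero_iff.mp h0).2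
  obtain ⟨A', hA'⟩ : g ∣ A := EuclideanDomain.gcd_dvd_left A B
  obtain ⟨B', hB'⟩ : g ∣ B := EuclideanDomain.gcd_dvd_right A B
  have hcop : IsCoprime A' B' := by
    refine ⟨EuclideanDomain.gcdA A B, EuclideanDomain.gcdB A B, mul_left_cancel₀ hg0 ?_⟩
    have hbez : g = A * EuclideanDomain.gcdA A B + B * EuclideanDomain.gcdB A B :=
      EuclideanDomain.gcd_eq_gcd_ab A B
    linear_combination -hbez - EuclideanDomain.gcdA A B * hA' - EuclideanDomain.gcdB A B * hB'
  have hB'0 : B' ≠ 0 := by rintro rfl; exact hB (by rw [hB', mul_zero])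
  have hσg : expand ℂ p g ≠ 0 := (expand_ne_zero (by omega)).mpr hg0
  have h' : expand ℂ p A' * B' = (U * A' - V * B') * expand ℂ p B' := by
    apply mul_left_cancel₀ (mul_ne_zero hσg hg0)
    have hσA : expand ℂ p A = expand ℂ p g * expand ℂ p A' := by rw [← map_mul, ← hA']
    have hσB : expand ℂ p B = expand ℂ p g * expand ℂ p B' := by rw [← map_mul, ← hB']
    rw [hσA, hσB] at h
    linear_combination h - expand ℂ p g * expand ℂ p A' * hB' +
      expand ℂ p g * expand ℂ p B' * (U * hA' - V * hB')
  have hdvd : expand ℂ p B' ∣ B' := by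
    have hc : IsCoprime (expand ℂ p A') (expand ℂ p B') := 
      (isCoprime_expand (by omega)).mpr hcop
    exact hc.symm.dvd_of_dvd_mul_left (Dvd.intro_left _ h'.symm)
  have hdeg : B'.natDegree = 0 := by
    have := natDegree_le_of_dvd hdvd hB'0
    rw [natDegree_expand] at this
    nlinarith
  obtain ⟨b, hb⟩ : ∃ b, B' = C b := ⟨_, eq_C_of_natDegree_eq_zero hdeg⟩
  have hb0 : b ≠ 0 := by rintro rfl; simp [hb] at hB'0
  have hbb : C b * C b⁻¹ = (1 : ℂ[X]) := by rw [← C_mul, mul_inv_cancel₀ hb0, C_1]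
  refine ⟨C b⁻¹ * A', ?_⟩
  rw [hb, expand_C] at h'
  have h2 : expand ℂ p A' = U * A' - V * C b := by
    apply mul_right_cancel₀ (b := C b) (by simpa using hb0)
    exact h'
  rw [map_mul, expand_C, h2]
  linear_combination -V * hbb

/-! ### Polynomial solutions for a character-like function -/

/-- The polynomial `∑ f(i) X ^ i`, `1 ≤ i ≤ M`, a truncation of the power series of `f`. -/
noncomputable def truncPoly (f : ℕ → ℤ) (M : ℕ) : ℤ[X] :=
  ∑ i ∈ Finset.range M, C (f (i + 1)) * X ^ (i + 1)

/-- The polynomial `1 + X + ⋯ + X ^ (p - 1)`, that is `(1 - X ^ p) / (1 - X)`. -/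
noncomputable def geomPoly (p : ℕ) : ℤ[X] := ∑ i ∈ Finset.range p, X ^ i

theorem coeff_truncPoly (f : ℕ → ℤ) (M n : ℕ) :
    (truncPoly f M).coeff n = if 1 ≤ n ∧ n ≤ M then f n else 0 := by
  rw [truncPoly, finsetSum_coeff]
  simp only [coeff_C_mul, coeff_X_pow, mul_ite, mul_one, mul_zero]
  rcases n with _ | n
  · simp
  · simp

theorem aeval_truncPoly (f : ℕ → ℤ) (M : ℕ) (z : ℂ) :
    aeval z (truncPoly f M) = ∑ i ∈ Finset.range M, (f (i + 1) : ℂ) * z ^ (i + 1) := by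
  simp [truncPoly]

theorem coeff_geomPoly (p n : ℕ) : (geomPoly p).coeff n = if n < p then 1 else 0 := by
  rw [geomPoly, finsetSum_coeff]
  simp [coeff_X_pow]

theorem geomPoly_ne_zero {p : ℕ} (hp : 0 < p) : geomPoly p ≠ 0 := fun h => by
  have := coeff_geomPoly p 0
  simp [h, hp] at this

namespace IsCharacterLike

variable {p : ℕ} {f : ℕ → ℤ}

/-- Multiplicativity and periodicity reduce each `f n` to the values at `1, …, p`. -/
theorem eq_one (hf : IsCharacterLike p f) (hp : 2 ≤ p) (h : ∀ i, 1 ≤ i → i ≤ p → f i = 1) :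
    ∀ n, 1 ≤ n → f n = 1 := by
  intro n
  induction n using Nat.strong_induction_on with
  | _ n ih =>
  intro hn
  have hdiv := Nat.div_add_mod' n p
  rcases Nat.eq_zero_or_pos (n % p) with h0 | h0
  · rw [h0, add_zero] at hdiv
    have hpos : 1 ≤ n / p := by
      rcases Nat.eq_zero_or_pos (n / p) with h1 | h1
      · simp [h1] at hdiv; omega
      · exact h1
    rw [← hdiv, hf.map_mul _ _ hpos (by omega), ih _ (Nat.div_lt_self hn hp) hpos,
      h p (by omega) le_rfl, one_mul]
  · have hlt := Nat.mod_lt n (show 0 < p by omega)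
    rw [← hdiv, hf.map_add _ _ h0 hlt, h _ h0 hlt.le]

/-- The Mahler equation of `(1 - z) F(z)` has a polynomial solution only for `f = 1`: comparing
degrees, the solution is `a₀ + a₁ X`, and then `f i = a₀ + a₁` for `1 ≤ i < p` and `f p = 1`. -/
theorem eq_one_of_polynomial_solution (hf : IsCharacterLike p f) (hp : 2 ≤ p) {A : ℂ[X]}
    (hA : expand ℂ p A = C (f p : ℂ) * (geomPoly p).map (Int.castRingHom ℂ) * A -
      C (f p : ℂ) * (truncPoly f (p - 1)).map (Int.castRingHom ℂ)) :
    ∀ n, 1 ≤ n → f n = 1 := by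
  set S := (geomPoly p).map (Int.castRingHom ℂ) with hS
  set P := (truncPoly f (p - 1)).map (Int.castRingHom ℂ) with hP
  have hScoeff : ∀ n, S.coeff n = if n < p then 1 else 0 := by
    intro n
    rw [hS, coeff_map, coeff_geomPoly]
    split_ifs <;> simp
  have hPcoeff : ∀ n, P.coeff n = if 1 ≤ n ∧ n ≤ p - 1 then (f n : ℂ) else 0 := by
    intro n
    rw [hP, coeff_map, coeff_truncPoly]
    split_ifs <;> simp
  have hε : (f p : ℂ) ≠ 0 := by
    rcases hf.values p (by omega) with h | h <;> simp [h]
  have hSdeg : S.natDegree ≤ p - 1 := natDegree_le_iff_coeff_eq_zero.mpr fun N hN => by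
    rw [hScoeff, if_neg (by omega)]
  have hPdeg : P.natDegree ≤ p - 1 := natDegree_le_iff_coeff_eq_zero.mpr fun N hN => by
    rw [hPcoeff, if_neg (by omega)]
  have hAdeg : A.natDegree ≤ 1 := by
    have h1 : A.natDegree * p ≤ p - 1 + A.natDegree := by
      rw [← natDegree_expand, hA]
      refine (natDegree_sub_le _ _).trans (max_le ?_ ?_)
      · rw [mul_assoc]
        exact (natDegree_C_mul_le _ _).trans (natDegree_mul_le.trans (by omega))
      · exact (natDegree_C_mul_le _ _).trans (by omega)
    obtain ⟨q, rfl⟩ : ∃ q, p = q + 2 := ⟨p - 2, by omega⟩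
    by_contra hlt
    obtain ⟨m, hm⟩ : ∃ m, A.natDegree = m + 2 := ⟨A.natDegree - 2, by omega⟩
    rw [hm] at h1
    have : (m + 2) * (q + 2) ≤ q + 1 + (m + 2) := by simpa using h1
    nlinarith
  -- The coefficients at `1 ≤ i < p`, at `p` and at `0` give the conditions on `a₀`, `a₁` and `f`.
  obtain ⟨a₁, a₀, rfl⟩ := exists_eq_X_add_C_of_natDegree_le_one hAdeg
  have hcoeff : ∀ n, (expand ℂ p (C a₁ * X + C a₀)).coeff (n + 1) =
      f p * (S.coeff n * a₁ + S.coeff (n + 1) * a₀) - f p * P.coeff (n + 1) := by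
    intro n
    rw [hA, coeff_sub, mul_assoc, coeff_C_mul, coeff_C_mul, mul_add, coeff_add, ← mul_assoc,
      coeff_mul_X, coeff_mul_C, coeff_mul_C]
  have hmid : ∀ i, 1 ≤ i → i < p → (f i : ℂ) = a₁ + a₀ := by
    intro i hi1 hip
    obtain ⟨n, rfl⟩ : ∃ n, i = n + 1 := ⟨i - 1, by omega⟩
    have := hcoeff n
    rw [coeff_expand (by omega), if_neg (Nat.not_dvd_of_pos_of_lt hi1 hip), hScoeff, hScoeff, hPcoeff,
      if_pos (by omega), if_pos hip, if_pos (by omega)] at this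
    apply mul_left_cancel₀ hε
    linear_combination this
  have hsum : a₁ + a₀ = 1 := by rw [← hmid 1 le_rfl (by omega), hf.map_one, Int.cast_one]
  have htop : a₁ = f p * a₁ := by
    obtain ⟨n, rfl⟩ : ∃ n, p = n + 1 := ⟨p - 1, by omega⟩
    have := hcoeff n
    rw [coeff_expand (by omega), if_pos dvd_rfl, Nat.div_self (by omega), hScoeff, hScoeff, hPcoeff,
      if_pos (by omega), if_neg (by omega), if_neg (by omega)] at this
    simpa using this
  have hbot : a₀ = f p * a₀ := by
    have := congrArg (fun q => q.coeff 0) hA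
    simp only [coeff_sub, mul_assoc, mul_coeff_zero, hScoeff, hPcoeff,
      coeff_expand (show 0 < p by omega)] at this
    simpa [show 0 < p by omega] using this
  refine hf.eq_one hp fun i hi1 hip => ?_
  have hcast : (f i : ℂ) = 1 := by
    rcases hip.eq_or_lt with rfl | hlt
    · linear_combination (-f i + 1 : ℂ) * hsum - htop - hbot
    · rw [hmid i hi1 hlt, hsum]
  exact_mod_cast hcast

end IsCharacterLike

/-! ### Liouville's inequality and the auxiliary polynomial -/

/-- A Liouville-type lower bound: a nonzero algebraic integer `B(β)` has a norm of absolute value at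
least `1`, so it cannot be small unless some conjugate `B(γ)` is large. -/
theorem exists_liouville_bound {β : ℂ} (hβ : IsIntegral ℤ β) :
    ∃ (d : ℕ) (c : ℝ), 0 ≤ c ∧ ∀ (B : ℤ[X]) (H : ℝ), 1 ≤ H → (∀ γ : ℂ, ‖γ‖ ≤ c → ‖aeval γ B‖ ≤ H) →
      aeval β B ≠ 0 → 1 ≤ ‖aeval β B‖ * H ^ d := by
  have hβQ : IsIntegral ℚ β := hβ.tower_top
  set K := IntermediateField.adjoin ℚ {β} with hK
  have : FiniteDimensional ℚ K := IntermediateField.adjoin.finiteDimensional hβQ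
  set θ : K := IntermediateField.AdjoinSimple.gen ℚ β with hθ
  obtain ⟨ι, hι⟩ : ∃ ι : K →ₐ[ℚ] ℂ, ι = K.val := ⟨_, rfl⟩
  have hθβ : ι θ = β := hι ▸ IntermediateField.AdjoinSimple.coe_gen ℚ β
  classical
  have hθint : IsIntegral ℤ θ := by
    have hinj : Function.Injective (K.val.restrictScalars ℤ) := K.val.injective
    rw [← isIntegral_algHom_iff (K.val.restrictScalars ℤ) hinj]
    exact hβ
  refine ⟨Fintype.card (K →ₐ[ℚ] ℂ), ∑ σ : K →ₐ[ℚ] ℂ, ‖σ θ‖,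
    Finset.sum_nonneg fun _ _ => norm_nonneg _,
    fun B H hH hB hne => ?_⟩
  have hσ : ∀ σ : K →ₐ[ℚ] ℂ, σ (aeval θ B) = aeval (σ θ) B := fun σ =>
    (aeval_algHom_apply (σ.restrictScalars ℤ) θ B).symm
  set x : K := aeval θ B with hx
  have hxβ : ι x = aeval β B := by rw [hσ, hθβ]
  have hx0 : x ≠ 0 := by
    rintro h0
    rw [h0, map_zero] at hxβ
    exact hne hxβ.symm
  have hxint : IsIntegral ℤ x := by
    rw [hx, aeval_eq_sum_range]
    exact IsIntegral.sum _ fun i _ => (hθint.pow i).smul _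
  obtain ⟨m, hm⟩ := IsIntegrallyClosed.isIntegral_iff.mp (Algebra.isIntegral_norm ℚ hxint)
  have hm0 : m ≠ 0 := by
    rintro rfl
    rw [map_zero] at hm
    exact hx0 (Algebra.norm_eq_zero_iff.mp hm.symm)
  have hprod := Algebra.norm_eq_prod_embeddings ℚ ℂ x
  rw [← hm] at hprod
  have hnorm : 1 ≤ ∏ σ : K →ₐ[ℚ] ℂ, ‖σ x‖ := by
    rw [← norm_prod, ← hprod]
    have : (1 : ℝ) ≤ |(m : ℝ)| := by exact_mod_cast Int.one_le_abs hm0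
    simpa using this
  have hle : ∀ σ : K →ₐ[ℚ] ℂ, ‖σ x‖ ≤ H := fun σ => by
    rw [hσ]
    exact hB _ (Finset.single_le_sum (f := fun σ : K →ₐ[ℚ] ℂ => ‖σ θ‖)
      (fun _ _ => norm_nonneg _) (Finset.mem_univ σ))
  rw [← Finset.mul_prod_erase _ _ (Finset.mem_univ ι), hxβ] at hnorm
  refine hnorm.trans (mul_le_mul_of_nonneg_left ?_ (norm_nonneg _))
  calc ∏ σ ∈ Finset.univ.erase ι, ‖σ x‖
      ≤ ∏ _σ ∈ Finset.univ.erase ι, H :=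
        Finset.prod_le_prod (fun _ _ => norm_nonneg _) fun σ _ => hle σ
    _ = H ^ (Finset.univ.erase ι).card := by rw [Finset.prod_const]
    _ ≤ H ^ Fintype.card (K →ₐ[ℚ] ℂ) :=
        pow_le_pow_right₀ hH (Finset.card_le_univ _)

/-- By linear algebra there are integers `a i j`, `i, j ≤ N`, not all zero, such that
`∑ a i j X ^ i T ^ j` vanishes to order `N ^ 2` at `0`: there are `(N + 1) ^ 2` unknowns and only
`N ^ 2` conditions. -/
theorem exists_auxiliary_coefficients (T : ℤ[X]) {N : ℕ} (hN : 0 < N) :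
    ∃ a : Fin (N + 1) → Fin (N + 1) → ℤ, a ≠ 0 ∧
      X ^ (N ^ 2) ∣ ∑ i, ∑ j, C (a i j) * X ^ (i : ℕ) * T ^ (j : ℕ) := by
  let M : Matrix (Fin (N ^ 2)) (Fin (N + 1) × Fin (N + 1)) ℤ :=
    fun n ij => (X ^ (ij.1 : ℕ) * T ^ (ij.2 : ℕ)).coeff n
  obtain ⟨t, ht0, ht, -⟩ := Int.Matrix.exists_ne_zero_int_vec_norm_le M
    (by simp only [Fintype.card_fin, Fintype.card_prod]; nlinarith) (by simpa using pow_pos hN 2)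
  refine ⟨fun i j => t (i, j), fun h => ht0 (funext fun ij => congrFun (congrFun h ij.1) ij.2), ?_⟩
  rw [X_pow_dvd_iff]
  intro n hn
  have := congrFun ht ⟨n, hn⟩
  simp only [Matrix.mulVec, dotProduct, M, Fintype.sum_prod_type, Pi.zero_apply] at this
  rw [← this]
  simp only [finsetSum_coeff, mul_assoc, coeff_C_mul]
  exact Finset.sum_congr rfl fun i _ => Finset.sum_congr rfl fun j _ => mul_comm _ _

/-! ### The generating function of a character-like function -/

namespace IsCharacterLike

variable {p : ℕ} {f : ℕ → ℤ}

theorem norm_term (hf : IsCharacterLike p f) (z : ℂ) (n : ℕ) :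
    ‖(f (n + 1) : ℂ) * z ^ (n + 1)‖ = ‖z‖ ^ (n + 1) := by
  have h1 : ‖(f (n + 1) : ℂ)‖ = 1 := by
    rcases hf.values (n + 1) (by omega) with h | h <;> simp [h]
  rw [norm_mul, norm_pow, h1, one_mul]

theorem summable_term (hf : IsCharacterLike p f) {z : ℂ} (hz : ‖z‖ < 1) :
    Summable fun n : ℕ => (f (n + 1) : ℂ) * z ^ (n + 1) := by
  refine Summable.of_norm ?_
  simp only [hf.norm_term]
  exact (summable_nat_add_iff 1).mpr (summable_geometric_of_lt_one (norm_nonneg z) hz)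

/-- Summation over residue classes modulo `p`. -/
theorem generatingFunction_eq (hf : IsCharacterLike p f) (hp : 2 ≤ p) {z : ℂ} (hz : ‖z‖ < 1) :
    generatingFunction f z = (1 - z ^ p)⁻¹ * aeval z (truncPoly f (p - 1)) +
      f p * generatingFunction f (z ^ p) := by
  have : NeZero p := ⟨by omega⟩
  have hzp : ‖z ^ p‖ < 1 := by
    rw [norm_pow]; exact pow_lt_one₀ (norm_nonneg z) hz (by omega)
  have hs := hf.summable_term hz
  have hs' := (Nat.divModEquiv p).symm.summable_iff.mpr hs
  have hblock : ∀ k : ℕ, ∑ i : Fin p, (f (k * p + i + 1) : ℂ) * z ^ (k * p + i + 1) =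
      (z ^ p) ^ k * aeval z (truncPoly f (p - 1)) +
        f p * ((f (k + 1) : ℂ) * (z ^ p) ^ (k + 1)) := by
    intro k
    obtain ⟨q, rfl⟩ : ∃ q, p = q + 1 := ⟨p - 1, by omega⟩
    rw [Fin.sum_univ_eq_sum_range
      (fun i => (f (k * (q + 1) + i + 1) : ℂ) * z ^ (k * (q + 1) + i + 1)) (q + 1),
      Finset.sum_range_succ, aeval_truncPoly, Finset.mul_sum, Nat.add_sub_cancel]
    congr 1
    · refine Finset.sum_congr rfl fun i hi => ?_
      rw [add_assoc, hf.map_add k (i + 1) (by omega) (by simpa using hi)]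
      ring
    · have : k * (q + 1) + q + 1 = (q + 1) * (k + 1) := by ring
      rw [this, hf.map_mul _ _ (by omega) (by omega)]
      push_cast
      ring
  have hgeom : Summable fun k : ℕ => (z ^ p) ^ k * aeval z (truncPoly f (p - 1)) :=
    (summable_geometric_of_norm_lt_one hzp).mul_right _
  calc generatingFunction f z
      = ∑' x : ℕ × Fin p, (f (x.1 * p + x.2 + 1) : ℂ) * z ^ (x.1 * p + x.2 + 1) :=
        ((Nat.divModEquiv p).symm.tsum_eq _).symm
    _ = ∑' k : ℕ, ∑ i : Fin p, (f (k * p + i + 1) : ℂ) * z ^ (k * p + i + 1) :=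
        (Summable.tsum_prod hs').trans (by simp only [tsum_fintype]; rfl)
    _ = _ := by
        simp only [hblock]
        rw [Summable.tsum_add hgeom ((hf.summable_term hzp).mul_left _), tsum_mul_left,
          tsum_mul_right, tsum_geometric_of_norm_lt_one hzp, generatingFunction]

theorem norm_generatingFunction_sub_le (hf : IsCharacterLike p f) (M : ℕ) {z : ℂ}
    (hz : ‖z‖ ≤ 1 / 2) :
    ‖generatingFunction f z - aeval z (truncPoly f M)‖ ≤ 2 * ‖z‖ ^ M := by
  have hz1 : ‖z‖ < 1 := by linarith
  have hs := hf.summable_term hz1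
  rw [generatingFunction, ← hs.sum_add_tsum_nat_add M, aeval_truncPoly, add_sub_cancel_left]
  have hg : HasSum (fun n : ℕ => ‖z‖ ^ n * ‖z‖ ^ M) ((1 - ‖z‖)⁻¹ * ‖z‖ ^ M) :=
    (hasSum_geometric_of_lt_one (norm_nonneg z) hz1).mul_right _
  refine (tsum_of_norm_bounded hg fun n => ?_).trans ?_
  · rw [hf.norm_term, ← pow_add]
    exact pow_le_pow_of_le_one (norm_nonneg z) hz1.le (by omega)
  · gcongr
    rw [inv_le_comm₀ (by linarith) two_pos]
    linarith

theorem analyticAt_generatingFunction (hf : IsCharacterLike p f) :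
    AnalyticAt ℂ (generatingFunction f) 0 := by
  have hd : DifferentiableOn ℂ (generatingFunction f) (Metric.ball 0 (1 / 2)) := by
    refine Complex.differentiableOn_tsum_of_summable_norm (u := fun n : ℕ => (1 / 2 : ℝ) ^ (n + 1))
      ?_ (fun n => ?_) Metric.isOpen_ball fun n z hz => ?_
    · exact (summable_nat_add_iff 1).mpr summable_geometric_two
    · fun_prop
    · rw [hf.norm_term]
      exact pow_le_pow_left₀ (norm_nonneg z) (mem_ball_zero_iff.mp hz).le _
  exact hd.analyticAt (Metric.ball_mem_nhds 0 (by norm_num))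

end IsCharacterLike

/-- The normalization `(1 - z) F(z)` of the generating function, whose Mahler equation has
polynomial coefficients. -/
noncomputable def mahlerFunction (f : ℕ → ℤ) (z : ℂ) : ℂ := (1 - z) * generatingFunction f z

namespace IsCharacterLike

variable {p : ℕ} {f : ℕ → ℤ}

theorem mahlerFunction_pow (hf : IsCharacterLike p f) (hp : 2 ≤ p) {z : ℂ} (hz : ‖z‖ < 1) :
    mahlerFunction f (z ^ p) = f p * (aeval z (geomPoly p) * mahlerFunction f z -
      aeval z (truncPoly f (p - 1))) := by
  have hε : (f p : ℂ) * f p = 1 := by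
    rcases hf.values p (by omega) with h | h <;> simp [h]
  have hzp : ‖z ^ p‖ < 1 := by
    rw [norm_pow]; exact pow_lt_one₀ (norm_nonneg z) hz (by omega)
  have hne : 1 - z ^ p ≠ 0 := by
    intro h
    rw [← sub_eq_zero.mp h, norm_one] at hzp
    exact lt_irrefl _ hzp
  have hS : aeval z (geomPoly p) * (1 - z) = 1 - z ^ p := by
    simp [geomPoly, geom_sum_mul_neg]
  have hF := hf.generatingFunction_eq hp hz
  rw [inv_mul_eq_div, div_add' _ _ _ hne, eq_div_iff hne] at hF
  rw [mahlerFunction, mahlerFunction]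
  linear_combination (-f p : ℂ) * hF - (f p : ℂ) * generatingFunction f z * hS -
    (1 - z ^ p) * generatingFunction f (z ^ p) * hε

theorem norm_mahlerFunction_sub_le (hf : IsCharacterLike p f) (M : ℕ) {z : ℂ} (hz : ‖z‖ ≤ 1 / 2) :
    ‖mahlerFunction f z - aeval z ((1 - X) * truncPoly f M)‖ ≤ 4 * ‖z‖ ^ M := by
  have h : mahlerFunction f z - aeval z ((1 - X) * truncPoly f M) =
      (1 - z) * (generatingFunction f z - aeval z (truncPoly f M)) := by
    simp [mahlerFunction]
    ring
  rw [h, norm_mul]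
  have h1 : ‖1 - z‖ ≤ 2 := (norm_sub_le _ _).trans (by rw [norm_one]; linarith)
  calc ‖1 - z‖ * ‖generatingFunction f z - aeval z (truncPoly f M)‖
      ≤ 2 * (2 * ‖z‖ ^ M) := by
        gcongr
        exact hf.norm_generatingFunction_sub_le M hz
    _ = 4 * ‖z‖ ^ M := by ring

theorem norm_mahlerFunction_le (hf : IsCharacterLike p f) {z : ℂ} (hz : ‖z‖ ≤ 1 / 2) :
    ‖mahlerFunction f z‖ ≤ 4 := by
  simpa [truncPoly] using hf.norm_mahlerFunction_sub_le 0 hz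

theorem analyticAt_mahlerFunction (hf : IsCharacterLike p f) :
    AnalyticAt ℂ (mahlerFunction f) 0 :=
  (analyticAt_const.sub analyticAt_id).mul hf.analyticAt_generatingFunction

/-- For `f ≠ 1` the function `(1 - z) F(z)` is transcendental over `ℂ(z)`. -/
theorem not_eventually_evalEval_eq_zero (hf : IsCharacterLike p f) (hp : 2 ≤ p)
    (hne : ∃ n : ℕ, 1 ≤ n ∧ f n ≠ 1) {Q : ℂ[X][X]} (hQ : Q ≠ 0) :
    ¬ ∀ᶠ z in 𝓝 (0 : ℂ), Q.evalEval z (mahlerFunction f z) = 0 := by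
  intro h
  have hε : (f p : ℂ) ≠ 0 := by
    rcases hf.values p (by omega) with h | h <;> simp [h]
  have hU : C (f p : ℂ) * (geomPoly p).map (Int.castRingHom ℂ) ≠ 0 :=
    mul_ne_zero (by simpa using hε) ((Polynomial.map_ne_zero_iff Int.cast_injective).mpr
      (geomPoly_ne_zero (by omega)))
  have heq : ∀ᶠ z in 𝓝 (0 : ℂ), mahlerFunction f (z ^ p) =
      (C (f p : ℂ) * (geomPoly p).map (Int.castRingHom ℂ)).eval z * mahlerFunction f z -
      (C (f p : ℂ) * (truncPoly f (p - 1)).map (Int.castRingHom ℂ)).eval z := by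
    filter_upwards [Metric.ball_mem_nhds (0 : ℂ) one_pos] with z hz
    rw [hf.mahlerFunction_pow hp (mem_ball_zero_iff.mp hz), eval_mul, eval_mul, eval_C, eval_map,
      eval_map, aeval_def, aeval_def, algebraMap_int_eq]
    ring
  obtain ⟨A, B, hB, hAB⟩ := exists_rational_solution_of_algebraic (by omega) hU heq hQ h
  obtain ⟨A₁, hA₁⟩ := exists_polynomial_solution hp hB hAB
  obtain ⟨n, hn, hn1⟩ := hne
  exact hn1 (hf.eq_one_of_polynomial_solution hp hA₁ n hn)

/-- The values at `2 ^ (-p ^ k)` are linear forms in the value at `1 / 2`, with integer coefficients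
after multiplication by `2 ^ p ^ k`. The bound on `m` is an equality, since
`∏ (2 ^ p ^ (j + 1) - 1) / (2 ^ p ^ j - 1)` telescopes. -/
theorem exists_linear_form (hf : IsCharacterLike p f) (hp : 2 ≤ p) (k : ℕ) :
    ∃ m n : ℤ, |m| = 2 * (2 ^ p ^ k - 1) ∧
      (2 : ℂ) ^ p ^ k * mahlerFunction f ((2 ^ p ^ k)⁻¹) = m * mahlerFunction f (1 / 2) + n := by
  induction k with
  | zero => exact ⟨2, 0, by norm_num, by norm_num⟩
  | succ k ih =>
    obtain ⟨m, n, hm, hmn⟩ := ih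
    set w : ℤ := 2 ^ p ^ k with hw
    have hw2 : 2 ≤ w := by
      rw [hw]
      exact le_self_pow₀ one_le_two (pow_pos (by omega) k).ne'
    have hwC : (2 : ℂ) ^ p ^ k = (w : ℂ) := by rw [hw]; push_cast; rfl
    have hw0 : (w : ℂ) ≠ 0 := by exact_mod_cast (by omega : w ≠ 0)
    have hwp : (2 : ℂ) ^ p ^ (k + 1) = (w : ℂ) ^ p := by rw [← hwC, ← pow_mul, pow_succ]
    have hwpZ : (2 : ℤ) ^ p ^ (k + 1) = w ^ p := by rw [hw, ← pow_mul, pow_succ]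
    set s : ℤ := ∑ i ∈ Finset.range p, w ^ i with hs
    set t : ℤ := ∑ i ∈ Finset.range (p - 1), f (i + 1) * w ^ (p - 1 - (i + 1)) with ht
    have hpw : (w : ℂ) ^ p = w ^ (p - 1) * w := by
      rw [← pow_succ, Nat.sub_add_cancel (by omega)]
    have hsC : (w : ℂ) ^ (p - 1) * aeval (w : ℂ)⁻¹ (geomPoly p) = s := by
      rw [hs, geomPoly, ← Finset.sum_range_reflect]
      simp only [map_sum, map_pow, aeval_X, Finset.mul_sum, Int.cast_sum, Int.cast_pow]
      refine Finset.sum_congr rfl fun i hi => ?_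
      have hi' := Finset.mem_range.mp hi
      rw [inv_pow, ← div_eq_mul_inv, div_eq_iff (pow_ne_zero _ hw0), ← pow_add]
      congr 1
      omega
    have htC : (w : ℂ) ^ (p - 1) * aeval (w : ℂ)⁻¹ (truncPoly f (p - 1)) = t := by
      rw [ht, aeval_truncPoly]
      simp only [Finset.mul_sum, Int.cast_sum, Int.cast_pow, Int.cast_mul]
      refine Finset.sum_congr rfl fun i hi => ?_
      have hi' := Finset.mem_range.mp hi
      rw [mul_left_comm, inv_pow, ← div_eq_mul_inv]
      congr 1
      rw [div_eq_iff (pow_ne_zero _ hw0), ← pow_add]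
      congr 1
      omega
    have hε : |f p| = 1 := by
      rcases hf.values p (by omega) with h | h <;> simp [h]
    refine ⟨f p * s * m, f p * (s * n - w * t), ?_, ?_⟩
    · have hs0 : 0 ≤ s := Finset.sum_nonneg fun i _ => by positivity
      rw [abs_mul, abs_mul, hε, hm, abs_of_nonneg hs0, hwpZ, ← geom_sum_mul w p]
      ring
    · have hnorm : ‖(w : ℂ)⁻¹‖ < 1 := by
        rw [norm_inv, Complex.norm_intCast, abs_of_pos (by exact_mod_cast (by omega : 0 < w))]
        exact inv_lt_one_of_one_lt₀ (by exact_mod_cast (by omega : 1 < w))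
      rw [hwC] at hmn
      rw [hwp, ← inv_pow, hf.mahlerFunction_pow hp hnorm, hpw]
      push_cast
      linear_combination (f p * s : ℂ) * hmn +
        (f p * w * mahlerFunction f (w : ℂ)⁻¹ : ℂ) * hsC - (f p * w : ℂ) * htC

end IsCharacterLike

/-! ### Transcendence of the value at one half -/

open Asymptotics in
/-- The auxiliary function: a polynomial of degree at most `N` in `z` and in `(1 - z) F(z)`, with
integer coefficients, that vanishes to order at least `N ^ 2` at `0` but not identically. -/
theorem IsCharacterLike.exists_auxiliary_function {p : ℕ} {f : ℕ → ℤ} (hf : IsCharacterLike p f)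
    (hp : 2 ≤ p) (hne : ∃ n : ℕ, 1 ≤ n ∧ f n ≠ 1) {N : ℕ} (hN : 0 < N) :
    ∃ (b : Fin (N + 1) → Fin (N + 1) → ℤ) (c : ℝ), ∀ᶠ z in 𝓝[≠] (0 : ℂ),
      ∑ i, ∑ j, (b i j : ℂ) * z ^ (i : ℕ) * mahlerFunction f z ^ (j : ℕ) ≠ 0 ∧
      ‖∑ i, ∑ j, (b i j : ℂ) * z ^ (i : ℕ) * mahlerFunction f z ^ (j : ℕ)‖ ≤ c * ‖z‖ ^ (N ^ 2) := by
  set G := mahlerFunction f with hG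
  set T : ℤ[X] := (1 - X) * truncPoly f (N ^ 2) with hT
  obtain ⟨b, hb0, R, hR⟩ := exists_auxiliary_coefficients T hN
  set E : ℂ → ℂ := fun z => ∑ i, ∑ j, (b i j : ℂ) * z ^ (i : ℕ) * G z ^ (j : ℕ) with hE
  have hGan : AnalyticAt ℂ G 0 := hf.analyticAt_mahlerFunction
  have hEan : AnalyticAt ℂ E 0 := by
    refine Finset.analyticAt_fun_sum _ fun i _ => Finset.analyticAt_fun_sum _ fun j _ => ?_
    exact (analyticAt_const.mul (analyticAt_id.pow _)).mul (hGan.pow _)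
  have hEne : ∀ᶠ z in 𝓝[≠] (0 : ℂ), E z ≠ 0 := by
    refine hEan.eventually_eq_zero_or_eventually_ne_zero.resolve_left fun h => ?_
    set Q : ℂ[X][X] := ∑ i : Fin (N + 1), ∑ j : Fin (N + 1),
      C (C (b i j : ℂ) * X ^ (i : ℕ)) * X ^ (j : ℕ) with hQ
    have hQ0 : Q ≠ 0 := by
      intro h0
      refine hb0 (funext fun i₀ => funext fun j₀ => ?_)
      have : (Q.coeff j₀).coeff i₀ = b i₀ j₀ := by
        simp only [hQ, finsetSum_coeff, coeff_C_mul_X_pow, Fin.val_inj, Finset.sum_ite_eq,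
          Finset.mem_univ, if_true]
      rw [h0, coeff_zero, coeff_zero] at this
      exact_mod_cast this.symm
    refine hf.not_eventually_evalEval_eq_zero hp hne hQ0 ?_
    filter_upwards [h] with z hz
    rw [← hz]
    simp [hQ, hE, evalEval_finsetSum, evalEval_C, hG]
  have hTcont : ∀ q : ℤ[X], ContinuousAt (fun z : ℂ => aeval z q) 0 := fun q =>
    q.continuous_aeval.continuousAt
  have hGT : (fun z => G z - aeval z T) =O[𝓝 0] fun z : ℂ => z ^ (N ^ 2) := by
    refine IsBigO.of_bound 4 ?_
    filter_upwards [Metric.closedBall_mem_nhds (0 : ℂ) (show (0 : ℝ) < 1 / 2 by norm_num)] with z hz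
    rw [norm_pow]
    exact hf.norm_mahlerFunction_sub_le _ (mem_closedBall_zero_iff.mp hz)
  -- Replacing `G` by its Taylor polynomial `T` changes each monomial by `O (z ^ N ^ 2)`.
  have hmono : ∀ i j : Fin (N + 1), (fun z => (b i j : ℂ) * z ^ (i : ℕ) * G z ^ (j : ℕ) -
      (b i j : ℂ) * z ^ (i : ℕ) * aeval z T ^ (j : ℕ)) =O[𝓝 0] fun z : ℂ => z ^ (N ^ 2) := by
    intro i j
    have hcont : ContinuousAt (fun z : ℂ => (b i j : ℂ) * z ^ (i : ℕ) *
        ∑ l ∈ Finset.range j, G z ^ l * aeval z T ^ ((j : ℕ) - 1 - l)) 0 := by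
      refine (continuousAt_const.mul (continuousAt_id.pow _)).mul (tendsto_finsetSum _ fun l _ => ?_)
      exact (hGan.continuousAt.pow l).mul ((hTcont T).pow _)
    refine ((hcont.isBigO_one ℂ).mul hGT).congr (fun z => ?_) (fun z => one_mul _)
    rw [mul_assoc, geom_sum₂_mul]
    ring
  have hpoly : (fun z : ℂ => ∑ i, ∑ j, (b i j : ℂ) * z ^ (i : ℕ) * aeval z T ^ (j : ℕ))
      =O[𝓝 0] fun z : ℂ => z ^ (N ^ 2) := by
    refine (((hTcont R).isBigO_one ℂ).mul (isBigO_refl (fun z : ℂ => z ^ (N ^ 2)) _)).congr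
      (fun z => ?_) (fun z => one_mul _)
    have := congrArg (aeval z) hR
    simp only [map_sum, _root_.map_mul, map_pow, aeval_X, map_intCast, eq_intCast] at this
    rw [this, mul_comm]
  have hEO : E =O[𝓝 0] fun z : ℂ => z ^ (N ^ 2) := by
    refine ((IsBigO.fun_sum (s := Finset.univ) fun i _ => IsBigO.fun_sum (s := Finset.univ)
      fun j _ => hmono i j).add hpoly).congr_left fun z => ?_
    simp only [hE, Finset.sum_sub_distrib, sub_add_cancel]
  obtain ⟨c, hc⟩ := hEO.bound
  refine ⟨b, c, ?_⟩
  filter_upwards [hEne, hc.filter_mono nhdsWithin_le_nhds] with z h1 h2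
  exact ⟨h1, by rwa [norm_pow] at h2⟩

/-- Clearing denominators in `∑ b i j z ^ i y ^ j`, at `z = 1 / W` and `W y = m α + n`, gives an
integer polynomial evaluated at `a α`. -/
theorem exists_cleared_polynomial {N : ℕ} (b : Fin (N + 1) → Fin (N + 1) → ℤ) (a W m n : ℤ) :
    ∃ B : ℤ[X],
      (∀ α y : ℂ, W ≠ 0 → (W : ℂ) * y = m * α + n → aeval (a • α) B =
        (W : ℂ) ^ N * (a * W) ^ N * ∑ i, ∑ j, (b i j : ℂ) * ((W : ℂ)⁻¹) ^ (i : ℕ) * y ^ (j : ℕ)) ∧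
      ∀ (γ : ℂ) (K : ℝ), 0 ≤ K → 1 ≤ W → ‖(m * γ + a * n : ℂ)‖ ≤ W * K → ‖aeval γ B‖ ≤
        (W : ℝ) ^ (2 * N) * ((|(a : ℝ)| + 1 + K) ^ N * ∑ i, ∑ j, |(b i j : ℝ)|) := by
  refine ⟨∑ i : Fin (N + 1), ∑ j : Fin (N + 1), C (b i j * W ^ (N - i) * (a * W) ^ (N - j)) *
    (C m * X + C (a * n)) ^ (j : ℕ), ?_, ?_⟩
  · intro α y hW hy
    have hW' : (W : ℂ) ≠ 0 := by exact_mod_cast hW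
    simp only [map_sum, map_mul, map_pow, map_add, aeval_X, map_intCast, eq_intCast,
      Finset.mul_sum, zsmul_eq_mul]
    refine Finset.sum_congr rfl fun i _ => Finset.sum_congr rfl fun j _ => ?_
    have h1 : (m : ℂ) * (a * α) + a * n = a * W * y := by linear_combination (-a : ℂ) * hy
    have h2 : (W : ℂ) ^ N = W ^ (N - i) * W ^ (i : ℕ) := by
      rw [← pow_add, Nat.sub_add_cancel (by omega)]
    have h3 : ((a * W : ℂ)) ^ N = (a * W) ^ (N - j) * (a * W) ^ (j : ℕ) := by
      rw [← pow_add, Nat.sub_add_cancel (by omega)]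
    have h4 : (W : ℂ) ^ (i : ℕ) * ((W : ℂ)⁻¹) ^ (i : ℕ) = 1 := by
      rw [← mul_pow, mul_inv_cancel₀ hW', one_pow]
    rw [h1, h2, h3, mul_pow _ y]
    linear_combination (-(b i j : ℂ) * W ^ (N - i) * (a * W) ^ (N - j) * ((a * W) ^ (j : ℕ) *
      y ^ (j : ℕ))) * h4
  · intro γ K hK hW hγ
    have hW1 : (1 : ℝ) ≤ W := by exact_mod_cast hW
    have hWn : ‖(W : ℂ)‖ = W := by
      rw [Complex.norm_intCast, abs_of_nonneg (by linarith)]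
    simp only [map_sum, map_mul, map_pow, map_add, aeval_X, map_intCast, eq_intCast,
      Finset.mul_sum]
    refine (norm_sum_le _ _).trans (Finset.sum_le_sum fun i _ => (norm_sum_le _ _).trans
      (Finset.sum_le_sum fun j _ => ?_))
    rw [norm_mul, norm_mul, norm_mul, norm_pow, norm_pow, norm_pow, norm_mul, hWn,
      Complex.norm_intCast, Complex.norm_intCast]
    set L := |(a : ℝ)| + 1 + K with hL
    have hL0 : 0 ≤ L := by positivity
    calc |(b i j : ℝ)| * (W : ℝ) ^ (N - i) * (|(a : ℝ)| * W) ^ (N - j) *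
          ‖(m * γ + a * n : ℂ)‖ ^ (j : ℕ)
        ≤ |(b i j : ℝ)| * (W : ℝ) ^ N * (L * W) ^ (N - j) * (L * W) ^ (j : ℕ) := by
          gcongr
          · omega
          · linarith
          · refine hγ.trans ?_
            rw [mul_comm]
            gcongr
            linarith [abs_nonneg (a : ℝ)]
      _ = (W : ℝ) ^ (2 * N) * (L ^ N * |(b i j : ℝ)|) := by
          rw [mul_assoc, ← pow_add, Nat.sub_add_cancel (by omega), mul_pow, two_mul, pow_add]
          ring

/-- The value of `(1 - z) F(z)` at `1 / 2` is transcendental. -/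
theorem IsCharacterLike.transcendental_mahlerFunction {p : ℕ} {f : ℕ → ℤ} (hf : IsCharacterLike p f)
    (hp : 2 ≤ p) (hne : ∃ n : ℕ, 1 ≤ n ∧ f n ≠ 1) :
    Transcendental ℤ (mahlerFunction f (1 / 2)) := by
  intro halg
  set α := mahlerFunction f (1 / 2) with hα
  obtain ⟨a, ha, hint⟩ := halg.exists_integral_multiple
  obtain ⟨d, c, hc, hliou⟩ := exists_liouville_bound hint
  -- The order `N ^ 2` of vanishing has to exceed the total exponent `2 N + 2 N d` of `2 ^ p ^ k`
  -- in the Liouville bound.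
  set N := 2 * d + 3 with hN
  obtain ⟨b, e, he⟩ := hf.exists_auxiliary_function hp hne (N := N) (by omega)
  set K : ℝ := 2 * c + |(a : ℝ)| * (4 + 2 * ‖α‖) with hK
  have hK0 : 0 ≤ K := by positivity
  set L : ℝ := 1 + (|(a : ℝ)| + 1 + K) ^ N * ∑ i, ∑ j, |(b i j : ℝ)| with hL
  have hL1 : 1 ≤ L := by
    rw [hL, le_add_iff_nonneg_right]
    exact mul_nonneg (by positivity)
      (Finset.sum_nonneg fun i _ => Finset.sum_nonneg fun j _ => abs_nonneg _)
  have hWtop : Tendsto (fun k : ℕ => (2 : ℝ) ^ p ^ k) atTop atTop :=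
    (tendsto_pow_atTop_atTop_of_one_lt one_lt_two).comp
      (tendsto_pow_atTop_atTop_of_one_lt (by omega : 1 < p))
  have hz : Tendsto (fun k : ℕ => ((2 : ℂ) ^ p ^ k)⁻¹) atTop (𝓝[≠] 0) := by
    rw [tendsto_nhdsWithin_iff]
    refine ⟨?_, Eventually.of_forall fun k => by simp⟩
    rw [tendsto_zero_iff_norm_tendsto_zero]
    simpa [Function.comp_def] using tendsto_inv_atTop_zero.comp hWtop
  obtain ⟨k, ⟨hE0, hEle⟩, hbig⟩ :=
    ((hz.eventually he).and (hWtop.eventually_gt_atTop (|(a : ℝ)| ^ N * e * L ^ d))).exists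
  obtain ⟨m, n, hm, hmn⟩ := hf.exists_linear_form hp k
  obtain ⟨W, hW⟩ : ∃ W : ℤ, W = 2 ^ p ^ k := ⟨_, rfl⟩
  have hWC : (2 : ℂ) ^ p ^ k = W := by rw [hW]; push_cast; rfl
  have hWR : (2 : ℝ) ^ p ^ k = W := by rw [hW]; push_cast; rfl
  have hW2 : 2 ≤ W := by
    rw [hW]
    exact le_self_pow₀ one_le_two (pow_pos (by omega) k).ne'
  have hW2R : (2 : ℝ) ≤ W := by exact_mod_cast hW2
  have hWpos : (0 : ℝ) < W := by linarith
  have hWn : ‖(W : ℂ)‖ = W := by rw [Complex.norm_intCast, abs_of_pos hWpos]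
  rw [hWC] at hE0 hEle hmn
  rw [hWR] at hbig
  rw [norm_inv, hWn] at hEle
  set y := mahlerFunction f (W : ℂ)⁻¹ with hy
  have hyle : ‖y‖ ≤ 4 := hf.norm_mahlerFunction_le (by
    rw [norm_inv, hWn, one_div]
    exact inv_anti₀ two_pos hW2R)
  have hmle : |(m : ℝ)| ≤ 2 * W := by
    have : |m| ≤ 2 * W := by rw [hm, ← hW]; omega
    exact_mod_cast this
  have hnle : |(n : ℝ)| ≤ W * (4 + 2 * ‖α‖) := by
    have h1 : (n : ℂ) = W * y - m * α := by linear_combination -hmn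
    rw [← Complex.norm_intCast, h1]
    refine (norm_sub_le _ _).trans ?_
    rw [norm_mul, norm_mul, hWn, Complex.norm_intCast]
    nlinarith [norm_nonneg α, mul_le_mul_of_nonneg_right hmle (norm_nonneg α),
      mul_le_mul_of_nonneg_left hyle hWpos.le]
  obtain ⟨B, hB1, hB2⟩ := exists_cleared_polynomial b a W m n
  have hBα := hB1 α y (by omega) hmn
  have hWN : (1 : ℝ) ≤ (W : ℝ) ^ (2 * N) := one_le_pow₀ (by linarith)
  have hlow := hliou B ((W : ℝ) ^ (2 * N) * L) (one_le_mul_of_one_le_of_one_le hWN hL1)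
    (fun γ hγ => by
      refine (hB2 γ K hK0 (by omega) ?_).trans (mul_le_mul_of_nonneg_left (by linarith) (by linarith))
      refine (norm_add_le _ _).trans ?_
      rw [norm_mul, norm_mul, Complex.norm_intCast, Complex.norm_intCast, Complex.norm_intCast]
      calc |(m : ℝ)| * ‖γ‖ + |(a : ℝ)| * |(n : ℝ)|
          ≤ (2 * W) * c + |(a : ℝ)| * (W * (4 + 2 * ‖α‖)) := by gcongr
        _ = W * K := by rw [hK]; ring)
    (by
      rw [hBα]
      have hW0 : (W : ℂ) ≠ 0 := by exact_mod_cast (by omega : W ≠ 0)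
      have ha0 : (a : ℂ) ≠ 0 := by exact_mod_cast ha
      exact mul_ne_zero (mul_ne_zero (pow_ne_zero _ hW0) (pow_ne_zero _ (mul_ne_zero ha0 hW0))) hE0)
  rw [hBα, norm_mul, norm_mul, norm_pow, norm_pow, norm_mul, hWn, Complex.norm_intCast] at hlow
  have hfin : 1 ≤ (W : ℝ) ^ N * (|(a : ℝ)| * W) ^ N * (e * ((W : ℝ)⁻¹) ^ (N ^ 2)) *
      ((W : ℝ) ^ (2 * N) * L) ^ d :=
    hlow.trans (by gcongr)
  have hexp : (W : ℝ) ^ N * (|(a : ℝ)| * W) ^ N * (e * ((W : ℝ)⁻¹) ^ (N ^ 2)) *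
      ((W : ℝ) ^ (2 * N) * L) ^ d = |(a : ℝ)| ^ N * e * L ^ d / (W : ℝ) ^ N := by
    have hsq : N ^ 2 = N + N + 2 * N * d + N := by rw [hN]; ring
    rw [hsq, inv_pow, pow_add _ _ N, pow_add _ _ (2 * N * d), pow_add _ N N, mul_pow, mul_pow,
      ← pow_mul]
    field_simp
  rw [hexp, le_div_iff₀ (by positivity), one_mul] at hfin
  have : (W : ℝ) ≤ (W : ℝ) ^ N := le_self_pow₀ (by linarith) (by omega)
  linarith

theorem mainTheorem2 (p : ℕ) (hp : p.Prime) (hodd : Odd p) (f : ℕ → ℤ)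
    (hf : IsCharacterLike p f) (hne : ∃ n : ℕ, 1 ≤ n ∧ f n ≠ 1) :
    Transcendental ℚ (generatingFunction f (1 / 2)) := by
  intro halg
  refine hf.transcendental_mahlerFunction hp.two_le hne ?_
  have hhalf : IsAlgebraic ℚ (1 - 1 / 2 : ℂ) := by
    have := isAlgebraic_algebraMap (R := ℚ) (A := ℂ) (1 - 1 / 2)
    simpa using this
  exact (IsFractionRing.isAlgebraic_iff ℤ ℚ ℂ).mpr (hhalf.mul halg)
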